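/- Let $n\ge 0$ and let $f:\{0,1\}^n\to\{0,1\}$ be a Boolean function that is not of the form $f(x)=x_i$ or $f(x)=1-x_i$ for any coordinate $i$. Let $d(f)$ be the degree of the unique multilinear real polynomial that agrees with $f$ on $\{0,1\}^n$. For $x\in\{0,1\}^n$ and $R\subseteq\{1,\dots,n\}$ let $x^{(R)}$ be $x$ with the bits in $R$ negated; let $bs(f,x)$ be the largest $t$ for which there are pairwise disjoint blocks $R_1,\dots,R_t\subseteq\{1,\dots,n\}$ with $f(x^{(R_j)})\neq f(x)$ for $j=1,\dots,t$, and let $bs(f)=\max_{x\in\{0,1\}^n} bs(f,x)$. Then $$d(f)^2\;\ge\;(\sqrt{10}-2)\,bs(f),\qquad \sqrt{10}-2\approx 1.16 .$$ -/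

import Mathlib

noncomputable section

namespace BoolFun

/-- The real number `0` or `1` attached to a bit. -/
def toReal (b : Bool) : ℝ := if b then 1 else 0

/-- The polynomial `p` represents `f`: it is multilinear (degree at most one in each variable)
and agrees with `f` on the points of the cube. -/
def Represents {n : ℕ} (p : MvPolynomial (Fin n) ℝ) (f : (Fin n → Bool) → Bool) : Prop :=
  (∀ i, p.degreeOf i ≤ 1) ∧ ∀ x, MvPolynomial.eval (fun i => toReal (x i)) p = toReal (f x)

/-- The multilinear real polynomial representing `f`. -/
def poly {n : ℕ} (f : (Fin n → Bool) → Bool) : MvPolynomial (Fin n) ℝ :=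
  ∑ a : Fin n → Bool, MvPolynomial.C (toReal (f a)) *
    ∏ i, (if a i then MvPolynomial.X i else 1 - MvPolynomial.X i)

theorem poly_represents {n : ℕ} (f : (Fin n → Bool) → Bool) : Represents (poly f) f := by
  classical
  constructor
  · intro i
    refine (MvPolynomial.degreeOf_sum_le _ _ _).trans (Finset.sup_le fun a _ => ?_)
    refine (MvPolynomial.degreeOf_C_mul_le _ _ _).trans ?_
    refine (MvPolynomial.degreeOf_prod_le _ _ _).trans ?_
    have h : ∀ j : Fin n, MvPolynomial.degreeOf i
        (if a j then MvPolynomial.X j else 1 - MvPolynomial.X j : MvPolynomial (Fin n) ℝ)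
        ≤ if i = j then 1 else 0 := by
      intro j
      split_ifs with h1 h2 h2
      · exact (MvPolynomial.degreeOf_X i j).le.trans (by simp [h2])
      · exact (MvPolynomial.degreeOf_X i j).le.trans (by simp [h2])
      · refine (MvPolynomial.degreeOf_sub_le _ _ _).trans ?_
        simp [h2]
      · refine (MvPolynomial.degreeOf_sub_le _ _ _).trans ?_
        simp [MvPolynomial.degreeOf_X, h2]
    refine (Finset.sum_le_sum fun j _ => h j).trans ?_
    simp
  · intro x
    simp only [poly, map_sum, map_mul, MvPolynomial.eval_C, map_prod]
    rw [Finset.sum_eq_single x]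
    · rw [Finset.prod_eq_one, mul_one]
      intro i _
      cases h : x i <;> simp [toReal, h]
    · intro a _ ha
      obtain ⟨i, hi⟩ := Function.ne_iff.mp ha
      rw [Finset.prod_eq_zero (Finset.mem_univ i), mul_zero]
      cases h : x i <;> cases h' : a i <;> simp_all [toReal]
    · simp

theorem represents_unique {n : ℕ} {f : (Fin n → Bool) → Bool} {p q : MvPolynomial (Fin n) ℝ}
    (hp : Represents p f) (hq : Represents q f) : p = q := by
  rw [← sub_eq_zero]
  refine MvPolynomial.eq_zero_of_eval_zero_at_prod_finset (p - q) (fun _ => {0, 1}) ?_ ?_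
  · intro i
    have h := MvPolynomial.degreeOf_sub_le i p q
    have h1 := hp.1 i
    have h2 := hq.1 i
    have h3 : ({0, 1} : Finset ℝ).card = 2 := by simp
    rw [h3]
    omega
  · intro x hx
    have h : x = fun i => toReal (decide (x i = 1)) := by
      funext i
      have := hx i
      simp only [Finset.mem_insert, Finset.mem_singleton] at this
      rcases this with h | h <;> simp [h, toReal]
    rw [h, map_sub, hp.2, hq.2, sub_self]

/-- `d(f)`: the degree of the multilinear real polynomial representing `f`. -/
def degree {n : ℕ} (f : (Fin n → Bool) → Bool) : ℕ := (poly f).totalDegree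

/-- The input `x` with the bits in the block `R` negated. -/
def flip {n : ℕ} (x : Fin n → Bool) (R : Finset (Fin n)) : Fin n → Bool :=
  fun i => if i ∈ R then !x i else x i

open Classical in
/-- `bs(f, x)`: the largest number of pairwise disjoint blocks each of which, when flipped in `x`,
changes the value of `f`. (Such blocks are automatically nonempty.) -/
def blockSensitivityAt {n : ℕ} (f : (Fin n → Bool) → Bool) (x : Fin n → Bool) : ℕ :=
  (Finset.univ.filter fun B : Finset (Finset (Fin n)) =>
    (B : Set (Finset (Fin n))).PairwiseDisjoint id ∧ ∀ R ∈ B, f (flip x R) ≠ f x).sup Finset.card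

/-- `bs(f)`: the maximum of `bs(f, x)` over all inputs `x`. -/
def blockSensitivity {n : ℕ} (f : (Fin n → Bool) → Bool) : ℕ :=
  Finset.univ.sup fun x : Fin n → Bool => blockSensitivityAt f x

end BoolFun

end

/-!
Fix an input `x` and `m` pairwise disjoint blocks, each of which changes the value of `f` when
negated in `x`. Negate every block independently with probability `μ`, and let `P μ` be the
probability that the value of `f` changes. Then:

* `P` is a polynomial in `μ` of degree at most `d = degree f`. By independence the expectation of a
  monomial in the coordinates is a product over the blocks of factors of degree at most one in `μ`,
  and the factor of a block that the monomial does not meet is `1`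
  (`natDegree_biasedMean_le_degree`).
* `P` maps all of `[0, 1]`, and not only a set of grid points, into `[0, 1]`
  (`eval_biasedMean_mem_Icc`).
* `P 0 = 0`, and comparing `P` at no block, one block and two blocks gives
  `P'' 0 ≤ -m (m - 1)` (`coeff_two_biasedMean_le`).

The Chebyshev polynomial `T d` has the largest second derivative at the endpoint `1` among the
polynomials of degree at most `d` bounded by `1` on `[-1, 1]`, and `T'' 1 = d² (d² - 1) / 3`.
Transported to `[0, 1]` this yields `m (m - 1) ≤ (2 / 3) d² (d² - 1)` (`card_mul_card_sub_one_le`).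
For `d ≥ 2` this is stronger than `(√10 - 2) m ≤ d²`, because `(√10 - 2)² < 3 / 2`. For `d ≤ 1` the
function `f` is constant or a coordinate up to negation (`flip_eq_of_degree_le_one`); in the first
case there is no sensitive block, and the second is excluded by hypothesis.
-/

namespace BoolFun

open Polynomial Finset

/-! ### Expectations under a biased random set of blocks -/

section Biased

variable {ι : Type*} [Fintype ι]

/-- The expectation of `v S` as a polynomial in `μ`, where the random set `S` contains each
element of `ι` independently with probability `μ`. -/
noncomputable def biasedMean (v : Finset ι → ℝ) : ℝ[X] :=
  ∑ S : Finset ι, C (v S) * (X ^ #S * (1 - X) ^ (Fintype.card ι - #S))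

theorem biasedMean_sum {κ : Type*} (s : Finset κ) (a : κ → ℝ) (v : κ → Finset ι → ℝ) :
    biasedMean (fun S => ∑ k ∈ s, a k * v k S) = ∑ k ∈ s, C (a k) * biasedMean (v k) := by
  simp only [biasedMean, map_sum, map_mul, sum_mul, mul_sum]
  rw [sum_comm]
  simp only [mul_assoc]

theorem biasedMean_const_mul (a : ℝ) (v : Finset ι → ℝ) :
    biasedMean (fun S => a * v S) = C a * biasedMean v := by
  simp only [biasedMean, map_mul, mul_sum, mul_assoc]

theorem biasedMean_one_sub (v : Finset ι → ℝ) :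
    biasedMean (fun S => 1 - v S) = 1 - biasedMean v := by
  simp only [biasedMean, map_sub, map_one, sub_mul, one_mul, sum_sub_distrib]
  rw [Fintype.sum_pow_mul_eq_add_pow]
  simp

/-- Independence: the expectation of a product over the elements of `ι` is the product of the
expectations. -/
theorem biasedMean_prod [DecidableEq ι] (w : ι → Bool → ℝ) :
    biasedMean (fun S => ∏ j, w j (decide (j ∈ S))) =
      ∏ j, (C (w j true) * X + C (w j false) * (1 - X)) := by
  rw [prod_add, powerset_univ]
  refine sum_congr rfl fun S _ => ?_
  have h : ∏ j, w j (decide (j ∈ S)) = (∏ j ∈ S, w j true) * ∏ j ∈ univ \ S, w j false := by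
    rw [← prod_mul_prod_compl S, compl_eq_univ_sdiff]
    congr 1
    · exact prod_congr rfl fun j hj => by simp [hj]
    · exact prod_congr rfl fun j hj => by
        have : j ∉ S := by simpa using hj
        simp [this]
  beta_reduce
  rw [h]
  simp only [prod_mul_distrib, prod_const, map_mul, map_prod, card_univ_sdiff]
  ring

theorem eval_biasedMean_mem_Icc {v : Finset ι → ℝ} (hv : ∀ S, v S ∈ Set.Icc (0 : ℝ) 1) {μ : ℝ}
    (hμ : μ ∈ Set.Icc (0 : ℝ) 1) : (biasedMean v).eval μ ∈ Set.Icc (0 : ℝ) 1 := by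
  have key : ∀ w : Finset ι → ℝ, (∀ S, 0 ≤ w S) → 0 ≤ (biasedMean w).eval μ := by
    intro w hw
    simp only [biasedMean, eval_finsetSum, eval_mul, eval_C, eval_pow, eval_X, eval_sub, eval_one]
    exact sum_nonneg fun S _ => mul_nonneg (hw S)
      (mul_nonneg (pow_nonneg hμ.1 _) (pow_nonneg (sub_nonneg.2 hμ.2) _))
  refine ⟨key v fun S => (hv S).1, ?_⟩
  have h := key (fun S => 1 - v S) fun S => sub_nonneg.2 (hv S).2
  rw [biasedMean_one_sub, eval_sub, eval_one] at h
  linarith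

theorem coeff_one_one_sub_X_pow (k : ℕ) : ((1 - X : ℝ[X]) ^ k).coeff 1 = -k := by
  induction k with
  | zero => simp [coeff_one]
  | succ k ih =>
    have h0 : ((1 - X : ℝ[X]) ^ k).coeff 0 = 1 := by simp [coeff_zero_eq_eval_zero]
    rw [pow_succ, mul_coeff_one, ih, h0]
    simp [coeff_one]

/-- If `v` vanishes at `∅`, equals `1` at the singletons and is at most `1` at the pairs, then the
second derivative of its biased expectation at `0` is very negative. -/
theorem coeff_two_biasedMean_le {v : Finset ι → ℝ} (h0 : v ∅ = 0) (h1 : ∀ j, v {j} = 1)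
    (h2 : ∀ S, v S ≤ 1) (hm : 2 ≤ Fintype.card ι) :
    (biasedMean v).coeff 2 ≤ -((Fintype.card ι : ℝ) * (Fintype.card ι - 1) / 2) := by
  classical
  set m := Fintype.card ι with hmdef
  let u : ℕ → ℝ := fun k => (if k = 1 then -((m : ℝ) - 1) else 0) + if k = 2 then 1 else 0
  have hterm : ∀ S : Finset ι,
      (C (v S) * (X ^ #S * (1 - X) ^ (m - #S))).coeff 2 ≤ u #S := by
    intro S
    rw [coeff_C_mul, coeff_X_pow_mul']
    rcases lt_trichotomy (#S) 1 with h | h | h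
    · have : S = ∅ := card_eq_zero.1 (by omega)
      subst this
      simp [h0, u]
    · obtain ⟨j, rfl⟩ := card_eq_one.1 h
      simp only [card_singleton, h1, one_mul, u]
      rw [if_pos (by norm_num), show 2 - 1 = 1 from rfl, coeff_one_one_sub_X_pow,
        Nat.cast_sub (by omega)]
      simp
    · by_cases h' : #S = 2
      · simp [h', u, coeff_zero_eq_eval_zero, h2 S]
      · rw [if_neg (by omega)]
        simp [u, h', h.ne']
  calc (biasedMean v).coeff 2 ≤ ∑ S : Finset ι, u #S := by
        rw [biasedMean, finsetSum_coeff]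
        exact sum_le_sum fun S _ => hterm S
    _ = ∑ k ∈ range (m + 1), m.choose k • u k := by
        rw [← powerset_univ, sum_powerset_apply_card, card_univ]
    _ = -((m : ℝ) * (m - 1) / 2) := by
        simp only [u, nsmul_eq_mul, mul_add, sum_add_distrib, mul_ite, mul_zero, sum_ite_eq',
          mem_range]
        rw [if_pos (by omega), if_pos (by omega), Nat.choose_one_right, Nat.cast_choose_two]
        ring

end Biased

/-! ### The degree of the expectation -/

section Degree

variable {n : ℕ} {ι : Type*} [DecidableEq ι]

/-- The input `x` with all blocks in `S` negated, where the disjoint blocks are the fibres of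
`c : Fin n → Option ι` over `some j`. -/
def flipBlocks (x : Fin n → Bool) (c : Fin n → Option ι) (S : Finset ι) : Fin n → Bool :=
  fun i => match c i with
    | none => x i
    | some j => if j ∈ S then !x i else x i

theorem flipBlocks_empty (x : Fin n → Bool) (c : Fin n → Option ι) : flipBlocks x c ∅ = x := by
  funext i
  unfold flipBlocks
  cases c i <;> simp

theorem flipBlocks_singleton {x : Fin n → Bool} {c : Fin n → Option ι} {j : ι}
    {R : Finset (Fin n)} (h : ∀ i, c i = some j ↔ i ∈ R) : flipBlocks x c {j} = flip x R := by
  funext i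
  unfold flipBlocks flip
  have := h i
  cases hc : c i with
  | none => simp_all
  | some k => by_cases hk : k = j <;> simp_all

variable [Fintype ι]

/-- A monomial is a product over the blocks, and a block in which it has no variable contributes
the constant factor `1`. -/
theorem natDegree_biasedMean_monomial_le (x : Fin n → Bool) (c : Fin n → Option ι)
    (e : Fin n → ℕ) :
    (biasedMean fun S => ∏ i, toReal (flipBlocks x c S i) ^ e i).natDegree ≤ ∑ i, e i := by
  let w : ι → Bool → ℝ := fun j b => ∏ i with c i = some j, toReal (if b then !x i else x i) ^ e i
  let a : ℝ := ∏ i with c i = none, toReal (x i) ^ e i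
  have hsplit : ∀ S, ∏ i, toReal (flipBlocks x c S i) ^ e i
      = a * ∏ j, w j (decide (j ∈ S)) := by
    intro S
    rw [← prod_fiberwise univ c, Fintype.prod_option]
    congr 1
    · refine prod_congr rfl fun i hi => ?_
      simp only [mem_filter, mem_univ, true_and] at hi
      simp [flipBlocks, hi]
    · refine prod_congr rfl fun j _ => prod_congr rfl fun i hi => ?_
      simp only [mem_filter, mem_univ, true_and] at hi
      simp [flipBlocks, hi]
  have hfactor : ∀ j, (C (w j true) * X + C (w j false) * (1 - X)).natDegree
      ≤ ∑ i with c i = some j, e i := by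
    intro j
    rcases Nat.eq_zero_or_pos (∑ i with c i = some j, e i) with h | h
    · have hw : ∀ b, w j b = 1 := fun b =>
        prod_eq_one fun i hi => by rw [sum_eq_zero_iff.1 h i hi, pow_zero]
      simp [hw]
    · refine le_trans ?_ (Nat.succ_le_of_lt h)
      compute_degree
  simp only [hsplit]
  rw [biasedMean_const_mul, biasedMean_prod]
  refine (natDegree_C_mul_le _ _).trans ((natDegree_prod_le _ _).trans ?_)
  refine (sum_le_sum fun j _ => hfactor j).trans ?_
  rw [← sum_fiberwise univ c e, Fintype.sum_option]
  exact Nat.le_add_left _ _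

theorem sum_le_degree {f : (Fin n → Bool) → Bool} {e : Fin n →₀ ℕ} (he : e ∈ (poly f).support) :
    ∑ i, e i ≤ degree f := by
  have h := MvPolynomial.le_totalDegree he
  rwa [Finsupp.sum_fintype _ _ fun _ => rfl] at h

theorem toReal_eq_sum_monomials (f : (Fin n → Bool) → Bool) (x : Fin n → Bool) :
    toReal (f x) = ∑ e ∈ (poly f).support, (poly f).coeff e * ∏ i, toReal (x i) ^ e i := by
  rw [← (poly_represents f).2 x, MvPolynomial.eval_eq']

theorem natDegree_biasedMean_le_degree (f : (Fin n → Bool) → Bool) (x : Fin n → Bool)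
    (c : Fin n → Option ι) :
    (biasedMean fun S => toReal (f (flipBlocks x c S))).natDegree ≤ degree f := by
  simp only [toReal_eq_sum_monomials f]
  rw [biasedMean_sum]
  refine natDegree_sum_le_of_forall_le _ _ fun e he => (natDegree_C_mul_le _ _).trans ?_
  exact (natDegree_biasedMean_monomial_le x c e).trans (sum_le_degree he)

end Degree

/-! ### Markov's inequality for the second derivative at an endpoint -/

theorem eval_one_iterate_derivative_two_T (d : ℕ) :
    (derivative^[2] (Chebyshev.T ℝ d)).eval 1 = (d : ℝ) ^ 2 * ((d : ℝ) ^ 2 - 1) / 3 := by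
  have h0 := Chebyshev.one_sub_X_sq_mul_iterate_derivative_T_eval (R := ℝ) d 0 1
  have h1 := Chebyshev.one_sub_X_sq_mul_iterate_derivative_T_eval (R := ℝ) d 1 1
  simp only [Function.iterate_zero, id, Chebyshev.T_eval_one] at h0
  push_cast at h0 h1
  norm_num at h0 h1 ⊢
  linear_combination (-1 / 3) * h1 - (d ^ 2 - 1) / 3 * h0

/-- The inequality of V. Markov at the left endpoint, transported from `[-1, 1]` to `[0, 1]`. -/
theorem neg_coeff_two_le {P : ℝ[X]} {d : ℕ} (hd : P.natDegree ≤ d)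
    (hP : ∀ μ ∈ Set.Icc (0 : ℝ) 1, P.eval μ ∈ Set.Icc (0 : ℝ) 1) :
    -P.coeff 2 ≤ (d : ℝ) ^ 2 * ((d : ℝ) ^ 2 - 1) / 3 := by
  -- `Q y = 1 - 2 P ((1 - y) / 2)` is bounded by `1` on `[-1, 1]`, and `Q'' 1 = -P'' 0 / 2`.
  let l : ℝ[X] := C (1 / 2) - C (1 / 2) * X
  let Q : ℝ[X] := 1 - C 2 * P.comp l
  have hl : l.natDegree ≤ 1 := by simp only [l]; compute_degree
  have hdeg : Q.degree ≤ d := by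
    refine degree_le_of_natDegree_le ?_
    refine (natDegree_sub_le _ _).trans (max_le (by simp) ?_)
    refine (natDegree_C_mul_le _ _).trans (natDegree_comp_le.trans ?_)
    nlinarith
  have hbnd : ∀ y ∈ Set.Icc (-1 : ℝ) 1, |Q.eval y| ≤ 1 := by
    intro y hy
    obtain ⟨ha, hb⟩ := hP (1 / 2 - 1 / 2 * y) ⟨by linarith [hy.2], by linarith [hy.1]⟩
    simp only [Q, l, eval_sub, eval_one, eval_mul, eval_C, eval_comp, eval_X]
    rw [abs_le]
    constructor <;> linarith
  have h := Chebyshev.eval_iterate_derivative_le_of_forall_abs_le_one (k := 2) le_rfl hdeg hbnd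
  rw [eval_one_iterate_derivative_two_T] at h
  have hl' : derivative l = C (-1 / 2) := by
    simp only [l, derivative_sub, derivative_C, derivative_mul, derivative_X]
    rw [zero_sub, zero_mul, zero_add, mul_one, ← C_neg]
    norm_num
  have hQ : (derivative^[2] Q).eval 1 = -P.coeff 2 := by
    have h2 : (derivative (derivative P)).eval 0 = 2 * P.coeff 2 := by
      rw [← coeff_zero_eq_eval_zero, coeff_derivative, coeff_derivative]
      norm_num
      ring
    have hQ1 : derivative Q = (derivative P).comp l := by
      have hC : C (2 : ℝ) * C (-1 / 2) = -1 := by rw [← C_mul]; norm_num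
      simp only [Q, derivative_sub, derivative_one, derivative_C_mul, derivative_comp, hl']
      linear_combination (-(derivative P).comp l) * hC
    simp only [Function.iterate_succ, Function.iterate_zero, Function.comp_apply, id, hQ1]
    rw [derivative_comp, hl', eval_mul, eval_C, eval_comp,
      show l.eval 1 = 0 by simp [l], h2]
    ring
  rwa [hQ] at h

/-! ### Bounding the number of blocks -/

theorem card_mul_card_sub_one_le {n : ℕ} (f : (Fin n → Bool) → Bool) (x : Fin n → Bool)
    (B : Finset (Finset (Fin n))) (hB : (B : Set (Finset (Fin n))).PairwiseDisjoint id)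
    (hflip : ∀ R ∈ B, f (flip x R) ≠ f x) (hm : 2 ≤ #B) :
    (#B : ℝ) * (#B - 1) ≤ 2 / 3 * ((degree f : ℝ) ^ 2 * ((degree f : ℝ) ^ 2 - 1)) := by
  classical
  -- The block containing a coordinate, if there is one.
  let c : Fin n → Option B := fun i =>
    if h : ∃ R : B, i ∈ (R : Finset (Fin n)) then some h.choose else none
  have hc : ∀ (R : B) i, c i = some R ↔ i ∈ (R : Finset (Fin n)) := by
    intro R i
    constructor
    · intro h
      simp only [c] at h
      split_ifs at h with hex
      rw [← Option.some.inj h]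
      exact hex.choose_spec
    · intro h
      have hex : ∃ R : B, i ∈ (R : Finset (Fin n)) := ⟨R, h⟩
      simp only [c, dif_pos hex, Option.some.injEq]
      by_contra hne
      exact disjoint_left.1 (hB hex.choose.2 R.2 fun h' => hne (Subtype.ext h'))
        hex.choose_spec h
  let v : Finset B → ℝ := fun S => if f (flipBlocks x c S) = f x then 0 else 1
  have hv : ∀ S, v S ∈ Set.Icc (0 : ℝ) 1 := by
    intro S
    simp only [v]
    split_ifs <;> simp
  have hdeg : (biasedMean v).natDegree ≤ degree f := by
    have h := natDegree_biasedMean_le_degree f x c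
    cases hx : f x with
    | false =>
      have : v = fun S => toReal (f (flipBlocks x c S)) := by
        funext S
        cases hS : f (flipBlocks x c S) <;> simp [v, hx, hS, toReal]
      rwa [this]
    | true =>
      have : v = fun S => 1 - toReal (f (flipBlocks x c S)) := by
        funext S
        cases hS : f (flipBlocks x c S) <;> simp [v, hx, hS, toReal]
      rw [this, biasedMean_one_sub]
      exact (natDegree_sub_le _ _).trans (max_le (by simp) h)
  have h1 := neg_coeff_two_le hdeg fun μ hμ => eval_biasedMean_mem_Icc hv hμ
  have h2 := coeff_two_biasedMean_le (v := v) (by simp [v, flipBlocks_empty])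
    (fun R => by simp [v, flipBlocks_singleton (hc R), hflip R R.2]) (fun S => (hv S).2)
    (by simpa using hm)
  rw [Fintype.card_coe] at h2
  linarith

theorem exists_blocks {n : ℕ} (f : (Fin n → Bool) → Bool) :
    ∃ (x : Fin n → Bool) (B : Finset (Finset (Fin n))),
      (B : Set (Finset (Fin n))).PairwiseDisjoint id ∧ (∀ R ∈ B, f (flip x R) ≠ f x) ∧
      #B = blockSensitivity f := by
  classical
  obtain ⟨x, -, hx⟩ := exists_mem_eq_sup (univ : Finset (Fin n → Bool)) univ_nonempty
    fun x => blockSensitivityAt f x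
  obtain ⟨B, hB, hBx⟩ := exists_mem_eq_sup
    (univ.filter fun B : Finset (Finset (Fin n)) =>
      (B : Set (Finset (Fin n))).PairwiseDisjoint id ∧ ∀ R ∈ B, f (flip x R) ≠ f x)
    ⟨∅, by simp⟩ card
  simp only [mem_filter, mem_univ, true_and] at hB
  refine ⟨x, B, hB.1, hB.2, ?_⟩
  rw [blockSensitivity, hx, blockSensitivityAt, ← hBx]

/-! ### Functions of degree at most one -/

/-- The polynomial is affine, so the effect of changing one coordinate is the same everywhere. -/
theorem toReal_update_sub_eq {n : ℕ} {f : (Fin n → Bool) → Bool} (hd : degree f ≤ 1) (i : Fin n)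
    (x y : Fin n → Bool) :
    toReal (f (Function.update x i true)) - toReal (f (Function.update x i false)) =
      toReal (f (Function.update y i true)) - toReal (f (Function.update y i false)) := by
  simp only [toReal_eq_sum_monomials f, ← sum_sub_distrib, ← mul_sub]
  refine sum_congr rfl fun e he => ?_
  congr 1
  have hsum := (sum_le_degree he).trans hd
  rw [← add_sum_erase univ _ (mem_univ i)] at hsum
  simp only [← mul_prod_erase univ _ (mem_univ i), Function.update_self]
  have hoff : ∀ (z : Fin n → Bool) (b : Bool), ∏ j ∈ univ.erase i,
      toReal (Function.update z i b j) ^ e j = ∏ j ∈ univ.erase i, toReal (z j) ^ e j :=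
    fun z b => prod_congr rfl fun j hj => by rw [Function.update_of_ne (ne_of_mem_erase hj)]
  simp only [hoff]
  rcases Nat.eq_zero_or_pos (e i) with h | h
  · simp [h]
  · have hz : ∑ j ∈ univ.erase i, e j = 0 := by omega
    have hone : ∀ z : Fin n → Bool, ∏ j ∈ univ.erase i, toReal (z j) ^ e j = 1 := fun z =>
      prod_eq_one fun j hj => by rw [sum_eq_zero_iff.1 hz j hj, pow_zero]
    rw [hone, hone]

/-- A function of degree at most one that is neither a coordinate nor a negated coordinate is
constant: if changing coordinate `i` changes the value at one input, it does so at every input and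
in the same direction, which makes `f` the coordinate `i` or its negation. -/
theorem flip_eq_of_degree_le_one {n : ℕ} {f : (Fin n → Bool) → Bool} (hd : degree f ≤ 1)
    (hf : ∀ i : Fin n, f ≠ (fun x => x i) ∧ f ≠ (fun x => !(x i))) (x : Fin n → Bool)
    (R : Finset (Fin n)) : f (flip x R) = f x := by
  have hupd : ∀ i (y : Fin n → Bool),
      f (Function.update y i true) = f (Function.update y i false) := by
    intro i y
    by_contra hne
    have hself : ∀ z : Fin n → Bool, f z = f (Function.update z i (z i)) := fun z => by
      rw [Function.update_eq_self]
    cases ht : f (Function.update y i true) <;> cases hf' : f (Function.update y i false)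
    · simp_all
    · refine (hf i).2 (funext fun z => ?_)
      have h := toReal_update_sub_eq hd i y z
      rw [hself z]
      cases h1 : f (Function.update z i true) <;> cases h2 : f (Function.update z i false) <;>
        cases h3 : z i <;> simp_all [toReal] <;> norm_num at h
    · refine (hf i).1 (funext fun z => ?_)
      have h := toReal_update_sub_eq hd i y z
      rw [hself z]
      cases h1 : f (Function.update z i true) <;> cases h2 : f (Function.update z i false) <;>
        cases h3 : z i <;> simp_all [toReal] <;> norm_num at h
    · simp_all
  have hany : ∀ i (y : Fin n → Bool) (b : Bool), f (Function.update y i b) = f y := by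
    intro i y b
    have h := hupd i y
    conv_rhs => rw [← Function.update_eq_self i y]
    cases b <;> cases y i <;> simp [h]
  induction R using Finset.induction_on with
  | empty => congr 1
  | insert i R hi ih =>
    have : flip x (insert i R) = Function.update (flip x R) i (!x i) := by
      funext j
      by_cases h : j = i
      · subst h; simp [flip]
      · simp [flip, h]
    rw [this, hany, ih]

end BoolFun

theorem theorem1 (n : ℕ) (f : (Fin n → Bool) → Bool)
    (hf : ∀ i : Fin n, f ≠ (fun x => x i) ∧ f ≠ (fun x => !(x i))) :
    (Real.sqrt 10 - 2) * (BoolFun.blockSensitivity f : ℝ) ≤ (BoolFun.degree f : ℝ) ^ 2 := by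
  obtain ⟨x, B, hB, hflip, hcard⟩ := BoolFun.exists_blocks f
  rw [← hcard]
  have hs : Real.sqrt 10 ≤ 3.1623 := Real.sqrt_le_iff.2 ⟨by norm_num, by norm_num⟩
  rcases Nat.lt_or_ge 1 (BoolFun.degree f) with hd | hd
  · have hd' : (2 : ℝ) ≤ BoolFun.degree f := by exact_mod_cast hd
    have hD : (4 : ℝ) ≤ (BoolFun.degree f : ℝ) ^ 2 := by nlinarith
    rcases Nat.lt_or_ge 1 B.card with hm | hm
    · have key := BoolFun.card_mul_card_sub_one_le f x B hB hflip hm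
      set D := (BoolFun.degree f : ℝ) ^ 2
      set m := (B.card : ℝ)
      have hm0 : (0 : ℝ) ≤ m := Nat.cast_nonneg _
      -- If `D < 1.1623 m`, then `D (D - 1) * 2 / 3` is smaller than `m (m - 1)` as soon as
      -- `m > 2.3`, and `D ≥ 4` forces `m > 3.4`.
      have : 1.1623 * m ≤ D := by
        by_contra! hlt
        have h1 : D * (D - 1) ≤ 1.1623 * m * (1.1623 * m - 1) := by nlinarith
        nlinarith
      nlinarith
    · have hm' : (B.card : ℝ) ≤ 1 := by exact_mod_cast hm
      have hm0 : (0 : ℝ) ≤ B.card := Nat.cast_nonneg _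
      nlinarith
  · have hempty : B = ∅ := Finset.eq_empty_of_forall_notMem fun R hR =>
      hflip R hR (BoolFun.flip_eq_of_degree_le_one hd hf x R)
    rw [hempty]
    simp only [Finset.card_empty, Nat.cast_zero, mul_zero]
    positivity
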